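/- Let $x_1,\dots,x_n$ be points of a set $\mathbb X$ (the treatments), let $\bar x_1,\dots,\bar x_q$ be their distinct values, each listed once, and put $d=n-q$. Let $f:\mathbb X\to\mathbb R^p$ be a function, $F$ the $n\times p$ matrix with $i$th row $f(x_i)^{T}$, and $Z$ the $n\times q$ matrix with $Z_{ij}=1$ if $x_i=\bar x_j$ and $Z_{ij}=0$ otherwise. For a matrix $A$ with $A^TA$ invertible write $H_A=A(A^TA)^{-1}A^T$; the matrix $Z^TZ$ is always invertible. Let $\bar\mu\in\mathbb R^q$, $\kappa>0$, let $\mathbf y\sim \mathrm N(Z\bar\mu,\kappa I_n)$, and write $Q=\mathbf y^T(I_n-H_Z)\mathbf y$. Then: (i) if $F^TF$ is invertible, then $\mathbf y^TH_F\mathbf y$ and $Q$ are independent; (ii) $F^T\mathbf y$ and $Q$ are independent; (iii) $Q/\kappa\sim\chi^2_d$, the law of the sum of squares of $d$ independent standard normal variables (the point mass at $0$ if $d=0$); (iv) if $d>2$, then $1/Q$ is integrable and $\mathrm E[1/Q]=\dfrac{1}{\kappa(d-2)}$; if $d>0$, then $\log Q$ is integrable and $\mathrm E[\log Q]=\log\kappa+\log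 2+\psi(d/2)$, where $\psi=\Gamma'/\Gamma$ is the digamma function. -/

import Mathlib

open MeasureTheory ProbabilityTheory Matrix

/-- `xbar` lists the distinct values of the treatments `x 1, …, x n`, each exactly once. -/
structure IsUniqueTreatments {𝕏 : Type*} {n q : ℕ} (x : Fin n → 𝕏) (xbar : Fin q → 𝕏) :
    Prop where
  injective : Function.Injective xbar
  range_eq : Set.range xbar = Set.range x

/-- Model matrix `F` of the linear model: its `i`th row is `f (x i)`. -/
def modelMatrix {𝕏 : Type*} {n p : ℕ} (f : 𝕏 → Fin p → ℝ) (x : Fin n → 𝕏) :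
    Matrix (Fin n) (Fin p) ℝ :=
  Matrix.of fun i => f (x i)

/-- Model matrix `Z` of the unique-treatment model: `Z i j = 1` if `x i = xbar j`, else `0`. -/
def treatmentMatrix {𝕏 : Type*} [DecidableEq 𝕏] {n q : ℕ} (x : Fin n → 𝕏) (xbar : Fin q → 𝕏) :
    Matrix (Fin n) (Fin q) ℝ :=
  Matrix.of fun i j => if x i = xbar j then 1 else 0

/-- The hat matrix `H_A = A (Aᵀ A)⁻¹ Aᵀ` (meaningful when `Aᵀ A` is invertible). -/
noncomputable def hatMatrix {n m : ℕ} (A : Matrix (Fin n) (Fin m) ℝ) :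
    Matrix (Fin n) (Fin n) ℝ :=
  A * (Aᵀ * A)⁻¹ * Aᵀ

/-- The quadratic form `‖u‖_V = uᵀ V u`. -/
noncomputable def quadForm {n : ℕ} (V : Matrix (Fin n) (Fin n) ℝ)
    (u : EuclideanSpace ℝ (Fin n)) : ℝ :=
  u.ofLp ⬝ᵥ (V *ᵥ u.ofLp)

/-- The `χ²_d` distribution: the law of the sum of squares of `d` independent standard normal
variables (for `d = 0` the point mass at `0`). -/
noncomputable def chiSquared (d : ℕ) : Measure ℝ :=
  (Measure.pi fun _ : Fin d => gaussianReal 0 1).map fun z => ∑ i, z i ^ 2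

/-- The pure-error quadratic form `u ↦ uᵀ (I_n - H_Z) u`. -/
noncomputable def pureErrorForm {𝕏 : Type*} [DecidableEq 𝕏] {n q : ℕ}
    (x : Fin n → 𝕏) (xbar : Fin q → 𝕏) (u : EuclideanSpace ℝ (Fin n)) : ℝ :=
  quadForm (1 - hatMatrix (treatmentMatrix x xbar)) u

/-!
Write `P` for the orthogonal projection onto the column space of `Z`, whose matrix is `H_Z`.
Since `κ I` is isotropic, `P y` and `(I - P) y` are independent. Every treatment is some `xbar j`,
so `F = Z G` where `G` has rows `f (xbar j)`; hence `Fᵀ y = Gᵀ Zᵀ P y` is a function of the first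
projection, while `Q = ‖(I - P) y‖²` is a function of the second. As `I - P` annihilates the mean,
`Q / κ` is the squared norm of a standard Gaussian vector on a space of dimension `n - q`.

Comparing moment generating functions near `0` identifies `χ²_d` with the Gamma distribution of
shape `d / 2` and rate `1 / 2`. Both moments come from `E[X ^ s] = Γ(a + s) / (Γ(a) r ^ s)` for `X`
of shape `a` and rate `r`: `s = -1` gives `E[1 / X]`, and, this being the moment generating
function of `log X`, its derivative at `s = 0` gives `E[log X]`.
-/

section MGF

open Filter Topology

lemma ext_of_mgf_id_eventuallyEq {μ ν : Measure ℝ} [IsFiniteMeasure μ] [IsFiniteMeasure ν]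
    (hμ : 0 ∈ interior (integrableExpSet id μ)) (h : mgf id μ =ᶠ[𝓝 0] mgf id ν) : μ = ν := by
  have hmass : μ.real Set.univ = ν.real Set.univ := by
    simpa only [mgf_zero'] using h.eq_of_nhds
  rcases eq_zero_or_neZero μ with rfl | _
  · exact (Measure.measure_univ_eq_zero.1 <| (measureReal_eq_zero_iff).1 <| by
      simpa using hmass.symm).symm
  have hν : 0 ∈ interior (integrableExpSet id ν) := by
    have : NeZero ν := ⟨fun hν => measureReal_univ_ne_zero (μ := μ) (by simp [hmass, hν])⟩
    rw [mem_interior_iff_mem_nhds] at hμ ⊢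
    filter_upwards [hμ, h] with t ht heq
    exact mgf_pos_iff.1 (heq ▸ mgf_pos_iff.2 ht)
  -- On the vertical strip over `S` both complex MGFs are analytic; they agree near `0` on the real
  -- axis, hence on the imaginary axis, where they are the characteristic functions.
  let S : Set ℝ := interior (integrableExpSet id μ) ∩ interior (integrableExpSet id ν)
  have hconn : IsPreconnected (Complex.re ⁻¹' S) :=
    ((convex_integrableExpSet.interior.inter convex_integrableExpSet.interior).linear_preimage
      Complex.reLm).isPreconnected
  have hfreq : ∃ᶠ z in 𝓝[≠] (0 : ℂ), complexMGF id μ z = complexMGF id ν z := by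
    have htend : Tendsto ((↑) : ℝ → ℂ) (𝓝[≠] 0) (𝓝[≠] 0) :=
      Complex.continuous_ofReal.continuousWithinAt.tendsto_nhdsWithin (by simp [Set.MapsTo])
    refine htend.frequently (Eventually.frequently ?_)
    filter_upwards [h.filter_mono nhdsWithin_le_nhds] with t ht
    rw [complexMGF_ofReal, complexMGF_ofReal, ht]
  have heq : Set.EqOn (complexMGF id μ) (complexMGF id ν) (Complex.re ⁻¹' S) :=
    (analyticOnNhd_complexMGF.mono fun _ hz => hz.1).eqOn_of_preconnected_of_frequently_eq
      (analyticOnNhd_complexMGF.mono fun _ hz => hz.2) hconn (by simpa using ⟨hμ, hν⟩) hfreq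
  refine Measure.ext_of_charFun (funext fun t => ?_)
  rw [← complexMGF_id_mul_I, ← complexMGF_id_mul_I]
  exact heq (by simpa using ⟨hμ, hν⟩)

end MGF

section Gamma

variable {a r : ℝ}

lemma gammaMeasure_eq_withDensity_restrict_Ioi (a r : ℝ) :
    gammaMeasure a r = (volume.restrict (Set.Ioi 0)).withDensity fun x =>
      ENNReal.ofReal (r ^ a / Real.Gamma a * x ^ (a - 1) * Real.exp (-(r * x))) := by
  have hpdf : gammaPDF a r = (Set.Ici 0).indicator fun x =>
      ENNReal.ofReal (r ^ a / Real.Gamma a * x ^ (a - 1) * Real.exp (-(r * x))) := by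
    funext x
    by_cases hx : 0 ≤ x <;> simp [gammaPDF, gammaPDFReal, hx]
  rw [gammaMeasure, hpdf, withDensity_indicator measurableSet_Ici,
    Measure.restrict_congr_set Ioi_ae_eq_Ici]

lemma ae_pos_gammaMeasure (a r : ℝ) : ∀ᵐ x ∂gammaMeasure a r, 0 < x := by
  rw [gammaMeasure_eq_withDensity_restrict_Ioi]
  exact (withDensity_absolutelyContinuous _ _).ae_le (ae_restrict_mem measurableSet_Ioi)

lemma gammaDensity_mul_rpow_mul_exp (a r s t : ℝ) {x : ℝ} (hx : 0 < x) :
    r ^ a / Real.Gamma a * x ^ (a - 1) * Real.exp (-(r * x)) * (x ^ s * Real.exp (t * x)) =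
      r ^ a / Real.Gamma a * (x ^ (a + s - 1) * Real.exp (-((r - t) * x))) := by
  rw [show a + s - 1 = (a - 1) + s by ring, Real.rpow_add hx,
    show -((r - t) * x) = -(r * x) + t * x by ring, Real.exp_add]
  ring

lemma integrable_rpow_mul_exp_gammaMeasure (ha : 0 < a) (hr : 0 < r) {s t : ℝ} (hs : -a < s)
    (ht : t < r) : Integrable (fun x => x ^ s * Real.exp (t * x)) (gammaMeasure a r) := by
  rw [gammaMeasure_eq_withDensity_restrict_Ioi,
    integrable_withDensity_iff_integrable_smul' (by fun_prop) (ae_of_all _ fun _ => by simp)]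
  have h := (integrableOn_rpow_mul_exp_neg_mul_rpow (s := a + s - 1) (p := 1) (by linarith) one_pos
    (sub_pos.2 ht)).const_mul (r ^ a / Real.Gamma a)
  refine IntegrableOn.congr_fun h (fun x (hx : 0 < x) => ?_) measurableSet_Ioi
  rw [ENNReal.toReal_ofReal (by positivity), smul_eq_mul, gammaDensity_mul_rpow_mul_exp a r s t hx,
    Real.rpow_one, neg_mul]

lemma integral_rpow_mul_exp_gammaMeasure (ha : 0 < a) (hr : 0 < r) {s t : ℝ} (hs : -a < s)
    (ht : t < r) : ∫ x, x ^ s * Real.exp (t * x) ∂gammaMeasure a r =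
      r ^ a / Real.Gamma a * (Real.Gamma (a + s) / (r - t) ^ (a + s)) := by
  have hrt : 0 < r - t := sub_pos.2 ht
  calc ∫ x, x ^ s * Real.exp (t * x) ∂gammaMeasure a r
    _ = ∫ x in Set.Ioi 0,
          r ^ a / Real.Gamma a * (x ^ (a + s - 1) * Real.exp (-((r - t) * x))) := by
      rw [gammaMeasure_eq_withDensity_restrict_Ioi,
        integral_withDensity_eq_integral_toReal_smul (by fun_prop)
          (ae_of_all _ fun _ => by simp)]
      refine setIntegral_congr_fun measurableSet_Ioi fun x (hx : 0 < x) => ?_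
      simp only [← gammaDensity_mul_rpow_mul_exp a r s t hx, smul_eq_mul]
      rw [ENNReal.toReal_ofReal (by positivity)]
    _ = _ := by
      rw [integral_const_mul, Real.integral_rpow_mul_exp_neg_mul_Ioi (by linarith) hrt, one_div,
        Real.inv_rpow hrt.le]
      ring

lemma mgf_id_gammaMeasure (ha : 0 < a) (hr : 0 < r) {t : ℝ} (ht : t < r) :
    mgf id (gammaMeasure a r) t = (r / (r - t)) ^ a := by
  have h := integral_rpow_mul_exp_gammaMeasure ha hr (s := 0) (by linarith) ht
  have hΓ := (Real.Gamma_pos_of_pos ha).ne'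
  simp only [Real.rpow_zero, one_mul, add_zero] at h
  rw [mgf, Real.div_rpow hr.le (sub_nonneg.2 ht.le)]
  simp only [id, h]
  field_simp

lemma zero_mem_interior_integrableExpSet_id_gammaMeasure (ha : 0 < a) (hr : 0 < r) :
    0 ∈ interior (integrableExpSet id (gammaMeasure a r)) := by
  refine interior_maximal (fun t (ht : t < r) => ?_) isOpen_Iio hr
  simpa [integrableExpSet] using
    integrable_rpow_mul_exp_gammaMeasure ha hr (s := 0) (by linarith) ht

lemma exp_mul_log_ae_eq_gammaMeasure (a r s : ℝ) :
    (fun x => Real.exp (s * Real.log x)) =ᵐ[gammaMeasure a r] fun x => x ^ s := by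
  filter_upwards [ae_pos_gammaMeasure a r] with x hx
  rw [Real.rpow_def_of_pos hx, mul_comm]

lemma integrable_rpow_gammaMeasure (ha : 0 < a) (hr : 0 < r) {s : ℝ} (hs : -a < s) :
    Integrable (fun x => x ^ s) (gammaMeasure a r) := by
  simpa using integrable_rpow_mul_exp_gammaMeasure ha hr hs hr

lemma integral_rpow_gammaMeasure (ha : 0 < a) (hr : 0 < r) {s : ℝ} (hs : -a < s) :
    ∫ x, x ^ s ∂gammaMeasure a r = Real.Gamma (a + s) / (Real.Gamma a * r ^ s) := by
  have h := integral_rpow_mul_exp_gammaMeasure ha hr hs hr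
  have hΓ := (Real.Gamma_pos_of_pos ha).ne'
  simp only [zero_mul, Real.exp_zero, mul_one, sub_zero] at h
  rw [h, Real.rpow_add hr]
  field_simp

lemma integrable_inv_gammaMeasure (ha : 1 < a) (hr : 0 < r) :
    Integrable (fun x => x⁻¹) (gammaMeasure a r) := by
  simpa only [Real.rpow_neg_one] using
    integrable_rpow_gammaMeasure (zero_lt_one.trans ha) hr (s := -1) (by linarith)

lemma integral_inv_gammaMeasure (ha : 1 < a) (hr : 0 < r) :
    ∫ x, x⁻¹ ∂gammaMeasure a r = r / (a - 1) := by
  have h := integral_rpow_gammaMeasure (zero_lt_one.trans ha) hr (s := -1) (by linarith)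
  have ha' : a - 1 ≠ 0 := by linarith
  have hΓ := (Real.Gamma_pos_of_pos (sub_pos.2 ha)).ne'
  have hΓ' := Real.Gamma_add_one ha'
  rw [sub_add_cancel] at hΓ'
  simp only [Real.rpow_neg_one, ← sub_eq_add_neg] at h
  rw [h, hΓ']
  field_simp

lemma zero_mem_interior_integrableExpSet_log_gammaMeasure (ha : 0 < a) (hr : 0 < r) :
    0 ∈ interior (integrableExpSet Real.log (gammaMeasure a r)) :=
  interior_maximal (fun s (hs : -a < s) => (integrable_congr
    (exp_mul_log_ae_eq_gammaMeasure a r s)).2 (integrable_rpow_gammaMeasure ha hr hs))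
    isOpen_Ioi (neg_lt_zero.2 ha)

lemma integrable_log_gammaMeasure (ha : 0 < a) (hr : 0 < r) :
    Integrable Real.log (gammaMeasure a r) :=
  integrable_of_mem_interior_integrableExpSet
    (zero_mem_interior_integrableExpSet_log_gammaMeasure ha hr)

lemma mgf_log_gammaMeasure (ha : 0 < a) (hr : 0 < r) {s : ℝ} (hs : -a < s) :
    mgf Real.log (gammaMeasure a r) s = Real.Gamma (a + s) / (Real.Gamma a * r ^ s) :=
  (integral_congr_ae (exp_mul_log_ae_eq_gammaMeasure a r s)).trans
    (integral_rpow_gammaMeasure ha hr hs)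

lemma integral_log_gammaMeasure (ha : 0 < a) (hr : 0 < r) :
    ∫ x, Real.log x ∂gammaMeasure a r = logDeriv Real.Gamma a - Real.log r := by
  have hΓ := (Real.Gamma_pos_of_pos ha).ne'
  have hmgf : mgf Real.log (gammaMeasure a r) =ᶠ[nhds 0]
      fun s => Real.Gamma (a + s) / Real.Gamma a * r ^ (-s) := by
    filter_upwards [Ioi_mem_nhds (neg_lt_zero.2 ha)] with s hs
    rw [mgf_log_gammaMeasure ha hr hs, Real.rpow_neg hr.le]
    field_simp
  have hderiv : HasDerivAt (fun s => Real.Gamma (a + s) / Real.Gamma a * r ^ (-s))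
      (logDeriv Real.Gamma a - Real.log r) 0 := by
    have hΓ' := (Real.differentiableAt_Gamma fun m =>
      (by linarith [m.cast_nonneg (α := ℝ)] : a ≠ -m)).hasDerivAt
    rw [← add_zero a] at hΓ'
    refine (((hΓ'.comp_const_add a 0).div_const (Real.Gamma a)).mul
      ((hasDerivAt_neg (0 : ℝ)).const_rpow hr)).congr_deriv ?_
    simp [logDeriv_apply, hΓ, sub_eq_add_neg]
  rw [← deriv_mgf_zero (zero_mem_interior_integrableExpSet_log_gammaMeasure ha hr),
    hmgf.deriv_eq, hderiv.deriv]

lemma digamma_ofReal (ha : ∀ m : ℕ, a ≠ -m) :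
    Complex.digamma a = ((logDeriv Real.Gamma a : ℝ) : ℂ) := by
  have hC := (Complex.differentiableAt_Gamma a fun m => by exact_mod_cast ha m).hasDerivAt
  have hR : HasDerivAt (fun x : ℝ => Complex.Gamma x) (deriv Real.Gamma a : ℝ) a := by
    simpa only [Complex.Gamma_ofReal] using (Real.differentiableAt_Gamma ha).hasDerivAt.ofReal_comp
  rw [Complex.digamma_def, logDeriv_apply, logDeriv_apply, hC.comp_ofReal.unique hR,
    Complex.Gamma_ofReal, Complex.ofReal_div]

lemma map_const_mul_gammaMeasure (ha : 0 < a) (hr : 0 < r) {c : ℝ} (hc : 0 < c) :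
    (gammaMeasure a r).map (c * ·) = gammaMeasure a (r / c) := by
  have hrc : 0 < r / c := div_pos hr hc
  have := isProbabilityMeasure_gammaMeasure ha hr
  have := isProbabilityMeasure_gammaMeasure ha hrc
  refine (ext_of_mgf_id_eventuallyEq
    (zero_mem_interior_integrableExpSet_id_gammaMeasure ha hrc) ?_).symm
  filter_upwards [Iio_mem_nhds hrc] with t (ht : t < r / c)
  have ht' : c * t < r := (lt_div_iff₀' hc).1 ht
  have hmgf : mgf (c * ·) (gammaMeasure a r) t = mgf id (gammaMeasure a r) (c * t) :=
    mgf_const_mul c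
  rw [mgf_id_map (by fun_prop), hmgf, mgf_id_gammaMeasure ha hrc ht,
    mgf_id_gammaMeasure ha hr ht', ← mul_div_mul_left (r / c) _ hc.ne', mul_sub,
    mul_div_cancel₀ _ hc.ne']

end Gamma

section ChiSquared

variable {d : ℕ}

lemma mgf_sq_gaussianReal {t : ℝ} (ht : t < 1 / 2) :
    mgf (fun x => x ^ 2) (gaussianReal 0 1) t = (1 / 2 / (1 / 2 - t)) ^ (1 / 2 : ℝ) := by
  have : 0 < 1 / 2 - t := sub_pos.2 ht
  have hdensity (x : ℝ) : gaussianPDFReal 0 1 x • Real.exp (t * x ^ 2) =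
      (√(2 * Real.pi))⁻¹ * Real.exp (-(1 / 2 - t) * x ^ 2) := by
    rw [gaussianPDFReal, show -(1 / 2 - t) * x ^ 2 = -(x - 0) ^ 2 / (2 * 1) + t * x ^ 2 by ring,
      Real.exp_add]
    simp [mul_assoc]
  rw [mgf, integral_gaussianReal_eq_integral_smul one_ne_zero]
  simp_rw [hdensity]
  rw [integral_const_mul, integral_gaussian, ← Real.sqrt_inv, ← Real.sqrt_mul (by positivity),
    Real.sqrt_eq_rpow]
  congr 1
  field_simp

lemma mgf_id_chiSquared (d : ℕ) (t : ℝ) :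
    mgf id (chiSquared d) t = mgf (fun x => x ^ 2) (gaussianReal 0 1) t ^ d := by
  have hmeas : Measurable fun z : Fin d → ℝ => ∑ i, z i ^ 2 := by fun_prop
  rw [mgf, chiSquared, integral_map hmeas.aemeasurable (by fun_prop)]
  simp_rw [id, Finset.mul_sum, Real.exp_sum]
  rw [integral_fintype_prod_eq_prod (f := fun _ (x : ℝ) => Real.exp (t * x ^ 2)),
    Finset.prod_const, Finset.card_univ, Fintype.card_fin]
  rfl

lemma chiSquared_eq_gammaMeasure (hd : 0 < d) :
    chiSquared d = gammaMeasure (d / 2) (1 / 2) := by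
  have ha : (0 : ℝ) < d / 2 := by positivity
  have := isProbabilityMeasure_gammaMeasure ha (one_half_pos (α := ℝ))
  have : IsProbabilityMeasure (chiSquared d) := Measure.isProbabilityMeasure_map
    (by fun_prop : Measurable fun z : Fin d → ℝ => ∑ i, z i ^ 2).aemeasurable
  refine (ext_of_mgf_id_eventuallyEq
    (zero_mem_interior_integrableExpSet_id_gammaMeasure ha one_half_pos) ?_).symm
  filter_upwards [Iio_mem_nhds (one_half_pos (α := ℝ))] with t (ht : t < 1 / 2)
  have hbase : 0 ≤ 1 / 2 / (1 / 2 - t) := div_nonneg one_half_pos.le (sub_nonneg.2 ht.le)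
  rw [mgf_id_gammaMeasure ha one_half_pos ht, mgf_id_chiSquared, mgf_sq_gaussianReal ht,
    ← Real.rpow_mul_natCast hbase, one_div_mul_eq_div]

variable {Ω : Type*} [MeasurableSpace Ω] {P : Measure Ω}

lemma integrable_comp_of_hasLaw {𝓧 E : Type*} [MeasurableSpace 𝓧] [NormedAddCommGroup E]
    {X : Ω → 𝓧} {μ : Measure 𝓧} (hX : HasLaw X μ P) {g : 𝓧 → E} (hg : Integrable g μ) :
    Integrable (fun ω => g (X ω)) P := by
  rw [← hX.map_eq] at hg
  exact hg.comp_aemeasurable hX.aemeasurable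

variable {Q : Ω → ℝ} {κ : ℝ}

lemma hasLaw_gammaMeasure_of_hasLaw_div_chiSquared (hκ : 0 < κ) (hd : 0 < d)
    (hQ : HasLaw (fun ω => Q ω / κ) (chiSquared d) P) :
    HasLaw Q (gammaMeasure (d / 2) (1 / (2 * κ))) P := by
  rw [chiSquared_eq_gammaMeasure hd] at hQ
  have hscale : HasLaw (κ * ·) (gammaMeasure (d / 2) (1 / (2 * κ)))
      (gammaMeasure (d / 2) (1 / 2)) :=
    ⟨by fun_prop, by rw [map_const_mul_gammaMeasure (by positivity) one_half_pos hκ, div_div]⟩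
  exact (hscale.comp hQ).congr (.of_eq (funext fun ω => (mul_div_cancel₀ (Q ω) hκ.ne').symm))

lemma integrable_one_div_of_hasLaw_div_chiSquared (hκ : 0 < κ) (hd : 2 < d)
    (hQ : HasLaw (fun ω => Q ω / κ) (chiSquared d) P) : Integrable (fun ω => 1 / Q ω) P := by
  have ha : (1 : ℝ) < d / 2 := by rw [lt_div_iff₀ two_pos]; exact_mod_cast hd
  simp only [one_div]
  exact integrable_comp_of_hasLaw (hasLaw_gammaMeasure_of_hasLaw_div_chiSquared hκ (by lia) hQ)
    (integrable_inv_gammaMeasure ha (by positivity))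

lemma integral_one_div_of_hasLaw_div_chiSquared (hκ : 0 < κ) (hd : 2 < d)
    (hQ : HasLaw (fun ω => Q ω / κ) (chiSquared d) P) :
    ∫ ω, 1 / Q ω ∂P = 1 / (κ * ((d : ℝ) - 2)) := by
  have ha : (1 : ℝ) < d / 2 := by rw [lt_div_iff₀ two_pos]; exact_mod_cast hd
  have h := (hasLaw_gammaMeasure_of_hasLaw_div_chiSquared hκ (by lia) hQ).integral_comp
    (f := fun x : ℝ => x⁻¹) (by fun_prop)
  simp only [Function.comp_def] at h
  simp only [one_div]
  rw [h, integral_inv_gammaMeasure ha (by positivity)]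
  have : (d : ℝ) - 2 ≠ 0 := by linarith
  have : (d : ℝ) / 2 - 1 ≠ 0 := by linarith
  field_simp

lemma integrable_log_of_hasLaw_div_chiSquared (hκ : 0 < κ) (hd : 0 < d)
    (hQ : HasLaw (fun ω => Q ω / κ) (chiSquared d) P) :
    Integrable (fun ω => Real.log (Q ω)) P :=
  integrable_comp_of_hasLaw (hasLaw_gammaMeasure_of_hasLaw_div_chiSquared hκ hd hQ)
    (integrable_log_gammaMeasure (by positivity) (by positivity))

lemma integral_log_of_hasLaw_div_chiSquared (hκ : 0 < κ) (hd : 0 < d)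
    (hQ : HasLaw (fun ω => Q ω / κ) (chiSquared d) P) :
    ((∫ ω, Real.log (Q ω) ∂P : ℝ) : ℂ) =
      ((Real.log κ + Real.log 2 : ℝ) : ℂ) + Complex.digamma ((d : ℂ) / 2) := by
  have ha : (0 : ℝ) < d / 2 := by positivity
  have hdigamma := digamma_ofReal fun m =>
    (by linarith [m.cast_nonneg (α := ℝ)] : (d / 2 : ℝ) ≠ -m)
  have h := (hasLaw_gammaMeasure_of_hasLaw_div_chiSquared hκ hd hQ).integral_comp
    (f := Real.log) (by fun_prop)
  simp only [Function.comp_def] at h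
  rw [h, integral_log_gammaMeasure ha (by positivity), one_div, Real.log_inv,
    Real.log_mul two_ne_zero hκ.ne']
  push_cast at hdigamma ⊢
  rw [hdigamma]
  ring

end ChiSquared

section Gaussian

variable {E : Type*} [NormedAddCommGroup E] [InnerProductSpace ℝ E] [FiniteDimensional ℝ E]
  [MeasurableSpace E] [BorelSpace E]

lemma map_norm_sq_stdGaussian :
    (stdGaussian E).map (fun v => ‖v‖ ^ 2) = chiSquared (Module.finrank ℝ E) := by
  rw [stdGaussian, Measure.map_map (by fun_prop) (by fun_prop), chiSquared]
  congr 1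
  funext z
  simp only [Function.comp_apply]
  rw [← (stdOrthonormalBasis ℝ E).sum_sq_norm_inner_right]
  simp [(stdOrthonormalBasis ℝ E).orthonormal.inner_right_fintype]

lemma map_orthogonalProjectionOnto_stdGaussian (V : Submodule ℝ E) :
    (stdGaussian E).map V.orthogonalProjectionOnto = stdGaussian V := by
  have := Measure.isProbabilityMeasure_map (μ := stdGaussian E) (f := V.orthogonalProjectionOnto)
    (by fun_prop)
  refine Measure.ext_of_charFun (funext fun t => ?_)
  rw [charFun_stdGaussian, charFun_apply, integral_map (by fun_prop) (by fun_prop)]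
  simp_rw [Submodule.inner_orthogonalProjectionOnto_eq_of_mem_right]
  rw [← charFun_apply, charFun_stdGaussian, Submodule.coe_norm]

variable {ι : Type*} [Fintype ι] [DecidableEq ι] {m : EuclideanSpace ℝ ι} {κ : ℝ}

open scoped MatrixOrder Matrix.Norms.L2Operator in
lemma multivariateGaussian_smul_one (m : EuclideanSpace ℝ ι) (hκ : 0 ≤ κ) :
    multivariateGaussian m (κ • (1 : Matrix ι ι ℝ)) =
      (stdGaussian (EuclideanSpace ℝ ι)).map fun z => m + √κ • z := by
  have hsqrt : CFC.sqrt (κ • (1 : Matrix ι ι ℝ)) = √κ • 1 :=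
    CFC.sqrt_unique (by rw [smul_mul_smul_comm, one_mul, Real.mul_self_sqrt hκ])
      (PosSemidef.one.smul (Real.sqrt_nonneg κ)).nonneg
  simp only [multivariateGaussian, hsqrt, map_smul, map_one, _root_.smul_apply,
    one_apply_eq_self]

variable {Ω : Type*} [MeasurableSpace Ω] {P : Measure Ω} {y : Ω → EuclideanSpace ℝ ι}

lemma hasLaw_norm_sq_orthogonalProjectionOnto_div (hκ : 0 < κ)
    (hy : HasLaw y (multivariateGaussian m (κ • (1 : Matrix ι ι ℝ))) P)
    {V : Submodule ℝ (EuclideanSpace ℝ ι)} (hm : m ∈ Vᗮ) :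
    HasLaw (fun ω => ‖V.orthogonalProjectionOnto (y ω)‖ ^ 2 / κ)
      (chiSquared (Module.finrank ℝ V)) P := by
  have hscale (z : EuclideanSpace ℝ ι) :
      ‖V.orthogonalProjectionOnto (m + √κ • z)‖ ^ 2 / κ = ‖V.orthogonalProjectionOnto z‖ ^ 2 := by
    rw [map_add, V.orthogonalProjectionOnto_eq_zero_iff.2 hm, zero_add, map_smul, norm_smul,
      mul_pow, Real.norm_of_nonneg (Real.sqrt_nonneg κ), Real.sq_sqrt hκ.le,
      mul_div_cancel_left₀ _ hκ.ne']
  rw [multivariateGaussian_smul_one m hκ.le] at hy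
  refine HasLaw.comp (Y := fun u => ‖V.orthogonalProjectionOnto u‖ ^ 2 / κ) ⟨by fun_prop, ?_⟩ hy
  rw [Measure.map_map (by fun_prop) (by fun_prop), ← map_norm_sq_stdGaussian,
    ← map_orthogonalProjectionOnto_stdGaussian, Measure.map_map (by fun_prop) (by fun_prop)]
  exact congrArg (Measure.map · _) (funext hscale)

lemma indepFun_orthogonalProjectionOnto_of_isOrtho (hκ : 0 ≤ κ)
    (hy : HasLaw y (multivariateGaussian m (κ • (1 : Matrix ι ι ℝ))) P)
    {U V : Submodule ℝ (EuclideanSpace ℝ ι)} (hUV : U ⟂ V) :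
    IndepFun (fun ω => U.orthogonalProjectionOnto (y ω))
      (fun ω => V.orthogonalProjectionOnto (y ω)) P := by
  have hG : HasGaussianLaw y P := ⟨by rw [hy.map_eq]; infer_instance⟩
  refine (hG.map (U.orthogonalProjectionOnto.prod V.orthogonalProjectionOnto)
    ).indepFun_of_covariance_inner (X := fun ω => U.orthogonalProjectionOnto (y ω))
    (Y := fun ω => V.orthogonalProjectionOnto (y ω)) fun s t => ?_
  have hst : (t : EuclideanSpace ℝ ι).ofLp ⬝ᵥ (s : EuclideanSpace ℝ ι).ofLp = 0 := by
    simpa [EuclideanSpace.inner_eq_star_dotProduct] using hUV.inner_eq s.2 t.2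
  simp_rw [Submodule.inner_orthogonalProjectionOnto_eq_of_mem_left]
  rw [hy.covariance_fun_comp (f := fun v => inner ℝ (s : EuclideanSpace ℝ ι) v)
    (g := fun v => inner ℝ (t : EuclideanSpace ℝ ι) v) (by fun_prop) (by fun_prop),
    ← covarianceBilin_apply_eq_cov IsGaussian.memLp_two_id,
    covarianceBilin_multivariateGaussian (PosSemidef.one.smul hκ), smul_mulVec, one_mulVec,
    dotProduct_smul, dotProduct_comm, hst, smul_zero]

end Gaussian

section HatMatrix

variable {n m : ℕ} {A : Matrix (Fin n) (Fin m) ℝ}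

/-- The column space of `A`, as a subspace of Euclidean space; `hatMatrix A` is the matrix of the
orthogonal projection onto it. -/
noncomputable def columnSpace (A : Matrix (Fin n) (Fin m) ℝ) :
    Submodule ℝ (EuclideanSpace ℝ (Fin n)) :=
  LinearMap.range (toEuclideanLin A)

lemma toLp_mulVec_mem_columnSpace (A : Matrix (Fin n) (Fin m) ℝ) (v : Fin m → ℝ) :
    WithLp.toLp 2 (A *ᵥ v) ∈ columnSpace A :=
  ⟨WithLp.toLp 2 v, rfl⟩

lemma mem_columnSpace_orthogonal_iff {u : EuclideanSpace ℝ (Fin n)} :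
    u ∈ (columnSpace A)ᗮ ↔ Aᵀ *ᵥ u.ofLp = 0 := by
  have hinner (v : EuclideanSpace ℝ (Fin m)) :
      inner ℝ (toEuclideanLin A v) u = (Aᵀ *ᵥ u.ofLp) ⬝ᵥ v.ofLp := by
    rw [EuclideanSpace.inner_eq_star_dotProduct, star_trivial, ofLp_toLpLin, toLin'_apply,
      dotProduct_mulVec, mulVec_transpose]
  simp only [columnSpace, Submodule.mem_orthogonal, LinearMap.mem_range, forall_exists_index,
    forall_apply_eq_imp_iff, hinner]
  exact ⟨fun h => dotProduct_eq_zero _ fun w => h (WithLp.toLp 2 w), fun h v => by simp [h]⟩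

lemma transpose_mul_hatMatrix (hA : IsUnit (Aᵀ * A)) : Aᵀ * hatMatrix A = Aᵀ := by
  rw [hatMatrix, ← Matrix.mul_assoc, ← Matrix.mul_assoc,
    mul_nonsing_inv _ ((isUnit_iff_isUnit_det _).1 hA), Matrix.one_mul]

lemma starProjection_columnSpace (hA : IsUnit (Aᵀ * A)) (u : EuclideanSpace ℝ (Fin n)) :
    (columnSpace A).starProjection u = WithLp.toLp 2 (hatMatrix A *ᵥ u.ofLp) := by
  refine Submodule.eq_starProjection_of_mem_orthogonal ?_ ?_
  · rw [hatMatrix, Matrix.mul_assoc, ← mulVec_mulVec]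
    exact toLp_mulVec_mem_columnSpace A _
  · rw [mem_columnSpace_orthogonal_iff, WithLp.ofLp_sub, mulVec_sub, mulVec_mulVec,
      transpose_mul_hatMatrix hA, sub_self]

lemma quadForm_one_sub_hatMatrix (hA : IsUnit (Aᵀ * A)) (u : EuclideanSpace ℝ (Fin n)) :
    quadForm (1 - hatMatrix A) u = ‖(columnSpace A)ᗮ.orthogonalProjectionOnto u‖ ^ 2 := by
  rw [← Submodule.re_inner_starProjection_eq_normSq, Submodule.starProjection_orthogonal_val,
    starProjection_columnSpace hA, quadForm, EuclideanSpace.inner_eq_star_dotProduct]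
  simp [sub_mulVec]

lemma quadForm_hatMatrix (A : Matrix (Fin n) (Fin m) ℝ) (u : EuclideanSpace ℝ (Fin n)) :
    quadForm (hatMatrix A) u = quadForm (Aᵀ * A)⁻¹ (WithLp.toLp 2 (Aᵀ *ᵥ u.ofLp)) := by
  rw [quadForm, quadForm, hatMatrix, ← mulVec_mulVec, ← mulVec_mulVec, dotProduct_mulVec,
    mulVec_transpose]

lemma finrank_columnSpace (hA : IsUnit (Aᵀ * A)) : Module.finrank ℝ (columnSpace A) = m := by
  calc Module.finrank ℝ (columnSpace A)
    _ = A.rank := (A.rank_eq_finrank_range_toLin (EuclideanSpace.basisFun _ ℝ).toBasis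
        (EuclideanSpace.basisFun _ ℝ).toBasis).symm
    _ = m := by rw [← rank_transpose_mul_self, rank_of_isUnit _ hA, Fintype.card_fin]

lemma finrank_columnSpace_orthogonal (hA : IsUnit (Aᵀ * A)) :
    Module.finrank ℝ (columnSpace A)ᗮ = n - m := by
  have h := (columnSpace A).finrank_add_finrank_orthogonal
  rw [finrank_columnSpace hA, finrank_euclideanSpace_fin] at h
  exact Nat.eq_sub_of_add_eq' h

variable {Ω : Type*} [MeasurableSpace Ω] {P : Measure Ω} {y : Ω → EuclideanSpace ℝ (Fin n)}
  {κ : ℝ}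

lemma hasLaw_quadForm_one_sub_hatMatrix (hA : IsUnit (Aᵀ * A)) (hκ : 0 < κ) (v : Fin m → ℝ)
    (hy : HasLaw y (multivariateGaussian (WithLp.toLp 2 (A *ᵥ v))
      (κ • (1 : Matrix (Fin n) (Fin n) ℝ))) P) :
    HasLaw (fun ω => quadForm (1 - hatMatrix A) (y ω) / κ) (chiSquared (n - m)) P := by
  simp_rw [quadForm_one_sub_hatMatrix hA, ← finrank_columnSpace_orthogonal hA]
  exact hasLaw_norm_sq_orthogonalProjectionOnto_div hκ hy
    (Submodule.le_orthogonal_orthogonal _ (toLp_mulVec_mem_columnSpace A v))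

lemma indepFun_transpose_mulVec_quadForm (hA : IsUnit (Aᵀ * A)) (hκ : 0 ≤ κ)
    {μ : EuclideanSpace ℝ (Fin n)}
    (hy : HasLaw y (multivariateGaussian μ (κ • (1 : Matrix (Fin n) (Fin n) ℝ))) P) :
    IndepFun (fun ω => Aᵀ *ᵥ (y ω).ofLp) (fun ω => quadForm (1 - hatMatrix A) (y ω)) P := by
  have hAy (u : EuclideanSpace ℝ (Fin n)) :
      Aᵀ *ᵥ ((columnSpace A).starProjection u).ofLp = Aᵀ *ᵥ u.ofLp := by
    rw [starProjection_columnSpace hA, mulVec_mulVec, transpose_mul_hatMatrix hA]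
  simp_rw [quadForm_one_sub_hatMatrix hA, fun ω => (hAy (y ω)).symm]
  exact (indepFun_orthogonalProjectionOnto_of_isOrtho hκ hy
      (columnSpace A).isOrtho_orthogonal_right).comp
    (φ := fun w : columnSpace A => Aᵀ *ᵥ (w : EuclideanSpace ℝ (Fin n)).ofLp)
    (ψ := fun w => ‖w‖ ^ 2) (by fun_prop) (by fun_prop)

end HatMatrix

section Treatment

variable {𝕏 : Type*} [DecidableEq 𝕏] {n q p : ℕ} {x : Fin n → 𝕏} {xbar : Fin q → 𝕏}

lemma injective_mulVec_treatmentMatrix (hx : IsUniqueTreatments x xbar) :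
    Function.Injective (treatmentMatrix x xbar).mulVec := by
  intro v w h
  funext j
  obtain ⟨i, hi⟩ : xbar j ∈ Set.range x := hx.range_eq ▸ Set.mem_range_self j
  simpa [mulVec, dotProduct, treatmentMatrix, hi, hx.injective.eq_iff] using congrFun h i

lemma isUnit_transpose_mul_treatmentMatrix (hx : IsUniqueTreatments x xbar) :
    IsUnit ((treatmentMatrix x xbar)ᵀ * treatmentMatrix x xbar) := by
  simpa only [conjTranspose_eq_transpose_of_trivial] using
    (PosDef.conjTranspose_mul_self _ (injective_mulVec_treatmentMatrix hx)).isUnit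

lemma modelMatrix_eq_treatmentMatrix_mul (hx : IsUniqueTreatments x xbar)
    (f : 𝕏 → Fin p → ℝ) :
    modelMatrix f x = treatmentMatrix x xbar * modelMatrix f xbar := by
  ext i k
  obtain ⟨j, hj⟩ : x i ∈ Set.range xbar := hx.range_eq ▸ Set.mem_range_self i
  simp [modelMatrix, treatmentMatrix, mul_apply, ← hj, hx.injective.eq_iff]

end Treatment

theorem lemma2 {𝕏 : Type*} [DecidableEq 𝕏] {n q p d : ℕ}
    (x : Fin n → 𝕏) (xbar : Fin q → 𝕏) (hx : IsUniqueTreatments x xbar) (hd : q + d = n)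
    (f : 𝕏 → Fin p → ℝ) (μbar : Fin q → ℝ) (κ : ℝ) (hκ : 0 < κ)
    {Ω : Type*} [MeasurableSpace Ω] (P : Measure Ω) [IsProbabilityMeasure P]
    (y : Ω → EuclideanSpace ℝ (Fin n))
    (hy : HasLaw y (multivariateGaussian (WithLp.toLp 2 (treatmentMatrix x xbar *ᵥ μbar))
      (κ • (1 : Matrix (Fin n) (Fin n) ℝ))) P) :
    IsUnit ((treatmentMatrix x xbar)ᵀ * treatmentMatrix x xbar) ∧
    (IsUnit ((modelMatrix f x)ᵀ * modelMatrix f x) →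
      IndepFun (fun ω => quadForm (hatMatrix (modelMatrix f x)) (y ω))
        (fun ω => pureErrorForm x xbar (y ω)) P) ∧
    IndepFun (fun ω => (modelMatrix f x)ᵀ *ᵥ (y ω).ofLp)
      (fun ω => pureErrorForm x xbar (y ω)) P ∧
    HasLaw (fun ω => pureErrorForm x xbar (y ω) / κ) (chiSquared d) P ∧
    (2 < d → Integrable (fun ω => 1 / pureErrorForm x xbar (y ω)) P ∧
      ∫ ω, 1 / pureErrorForm x xbar (y ω) ∂P = 1 / (κ * ((d : ℝ) - 2))) ∧
    (0 < d → Integrable (fun ω => Real.log (pureErrorForm x xbar (y ω))) P ∧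
      ((∫ ω, Real.log (pureErrorForm x xbar (y ω)) ∂P : ℝ) : ℂ) =
        ((Real.log κ + Real.log 2 : ℝ) : ℂ) + Complex.digamma ((d : ℂ) / 2)) := by
  have hZ := isUnit_transpose_mul_treatmentMatrix hx
  have hQ : HasLaw (fun ω => pureErrorForm x xbar (y ω) / κ) (chiSquared d) P := by
    rw [← Nat.sub_eq_of_eq_add' hd.symm]
    exact hasLaw_quadForm_one_sub_hatMatrix hZ hκ μbar hy
  have hFy : IndepFun (fun ω => (modelMatrix f x)ᵀ *ᵥ (y ω).ofLp)
      (fun ω => pureErrorForm x xbar (y ω)) P := by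
    simp_rw [modelMatrix_eq_treatmentMatrix_mul hx f, transpose_mul, ← mulVec_mulVec]
    exact (indepFun_transpose_mulVec_quadForm hZ hκ.le hy).comp
      (φ := fun w => (modelMatrix f xbar)ᵀ *ᵥ w) (by fun_prop) measurable_id
  have hFHy : IndepFun (fun ω => quadForm (hatMatrix (modelMatrix f x)) (y ω))
      (fun ω => pureErrorForm x xbar (y ω)) P := by
    simp_rw [quadForm_hatMatrix]
    exact hFy.comp (φ := fun w => quadForm _ (WithLp.toLp 2 w))
      (by unfold quadForm; fun_prop) measurable_id
  exact ⟨hZ, fun _ => hFHy, hFy, hQ,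
    fun h => ⟨integrable_one_div_of_hasLaw_div_chiSquared hκ h hQ,
      integral_one_div_of_hasLaw_div_chiSquared hκ h hQ⟩,
    fun h => ⟨integrable_log_of_hasLaw_div_chiSquared hκ h hQ,
      integral_log_of_hasLaw_div_chiSquared hκ h hQ⟩⟩
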